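/- \textbf{Setting.} Let $A\ge 1$ and let $M_{\mathrm{Lo}}, M_{\mathrm{Hi}}$ be two stochastic bandit tasks with the common arm set $[A]=\{1,\dots,A\}$; pulling arm $i$ in $M_{\mathrm{Lo}}$ (resp. $M_{\mathrm{Hi}}$) yields a reward in $[0,1]$ with mean $\mu_{\mathrm{Lo}}(i)$ (resp. $\mu_{\mathrm{Hi}}(i)$) whose conditional law, given everything that happened before the current iteration and the arm pulled, is the reward distribution of that arm. For $\bullet\in\{\mathrm{Lo},\mathrm{Hi}\}$ put $\mu_\bullet^*=\max_j\mu_\bullet(j)$, $\Delta_\bullet(i)=\mu_\bullet^*-\mu_\bullet(i)$, and let $\Delta_{\min}$ be the smallest gap $\Delta_\bullet(i)$ of a non-optimal arm over both tasks (for $A=1$, where there is none, all bounds below hold trivially, with regret $0$ and an empty sum). \textbf{Assumptions.} (i) Each of the two tasks has a unique optimal arm. (ii) Optimal value dominance (OVD): $\mu_{\mathrm{Lo}}^*\ge \mu_{\mathrm{Hi}}^*-\Delta_{\min}/2$. (iii) The learner knows a number $\tilde\Delta_{\min}$ with $0\le\tilde\Delta_{\min}\le\Delta_{\min}$. \textbf{Algorithm}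 (parameters $\alpha>2$ and $\epsilon\ge0$). Let $f(k)=1+16A^2(k+1)^2$; let $N_\bullet^k(i)$ and $\hat\mu_\bullet^k(i)$ be the number of pulls and the empirical mean of arm $i$ in task $M_\bullet$ before iteration $k$, and put $\overline\mu_\bullet^k(i)=\hat\mu_\bullet^k(i)+\sqrt{2\alpha\log f(k)/N_\bullet^k(i)}$ and $\underline\mu_\bullet^k(i)=\hat\mu_\bullet^k(i)-\sqrt{2\alpha\log f(k)/N_\bullet^k(i)}$. In the first $A$ iterations each arm is pulled once in each task. At every iteration $k>A$, the arm pulled in $M_{\mathrm{Lo}}$ is $\pi_{\mathrm{Lo}}^k\in\arg\max_i\overline\mu_{\mathrm{Lo}}^k(i)$. With $\underline\pi_{\mathrm{Lo}}^k\in\arg\max_i\underline\mu_{\mathrm{Lo}}^k(i)$, the arm pulled in $M_{\mathrm{Hi}}$ is $\pi_{\mathrm{Hi}}^k=\underline\pi_{\mathrm{Lo}}^k$ if $$\underline\mu_{\mathrm{Lo}}^k(\underline\pi_{\mathrm{Lo}}^k)\le\overline\mu_{\mathrm{Hi}}^k(\underline\pi_{\mathrm{Lo}}^k)+\epsilon\quad\text{and}\quad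 N_{\mathrm{Lo}}^k(\underline\pi_{\mathrm{Lo}}^k)>k/2,$$ and $\pi_{\mathrm{Hi}}^k\in\arg\max_i\overline\mu_{\mathrm{Hi}}^k(i)$ otherwise. Ties are broken arbitrarily. Let $\mathrm{Regret}_K(M_{\mathrm{Hi}})=\mathbb E\big[\sum_{k=1}^K(\mu_{\mathrm{Hi}}^*-\mu_{\mathrm{Hi}}(\pi_{\mathrm{Hi}}^k))\big]$. \textbf{Theorem.} For every $\alpha>2$ there is a constant $C>0$ depending only on $\alpha$ such that, under assumptions (i)--(iii), the algorithm run with this $\alpha$ and $\epsilon=\tilde\Delta_{\min}/4$ satisfies, for every $K\ge2$, $$\mathrm{Regret}_K(M_{\mathrm{Hi}})\le C\sum_{i:\,\Delta_{\mathrm{Hi}}(i)>0}\frac{1}{\Delta_{\mathrm{Hi}}(i)}\,\log K .$$ Moreover, if the two tasks are $\tilde\Delta_{\min}/4$-close, i.e. $\mu_{\mathrm{Lo}}^*-\mu_{\mathrm{Hi}}^*\le\tilde\Delta_{\min}/4$ and the optimal arms of the two tasks coincide, then for every $K$ $$\mathrm{Regret}_K(M_{\mathrm{Hi}})\le C\sum_{i:\,\Delta_{\mathrm{Hi}}(i)>0}\frac{1}{\Delta_{\mathrm{Hi}}(i)}\,\log\frac{A}{\Delta_{\min}}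 .$$ -/

import Mathlib

open MeasureTheory ProbabilityTheory

namespace TieredMAB

noncomputable section

/-! ### Stochastic multi-armed bandits with rewards in `[0, 1]` -/

/-- A stochastic bandit task with `A` arms: one reward distribution on `[0, 1]` per arm. -/
structure Bandit (A : ℕ) where
  /-- the reward distribution of each arm -/
  law : Fin A → Measure ℝ
  isProb : ∀ i, IsProbabilityMeasure (law i)
  mem_Icc : ∀ i, ∀ᵐ x ∂(law i), x ∈ Set.Icc (0 : ℝ) 1

namespace Bandit

variable {A : ℕ}

/-- The expected reward of arm `i`. -/
def mean (M : Bandit A) (i : Fin A) : ℝ := ∫ x, x ∂(M.law i)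

/-- The optimal value `max_j μ(j)`. -/
def bestMean (M : Bandit A) : ℝ := ⨆ j, M.mean j

/-- The gap `Δ(i) = max_j μ(j) - μ(i)`. -/
def gap (M : Bandit A) (i : Fin A) : ℝ := M.bestMean - M.mean i

/-- Arm `i` is optimal. -/
def IsOptimal (M : Bandit A) (i : Fin A) : Prop := ∀ j, M.mean j ≤ M.mean i

/-- The smallest gap of a non-optimal arm (`0` if there is no such arm; under uniqueness of the
optimal arm this happens only for `A = 1`, when every regret is zero). -/
def minGap (M : Bandit A) : ℝ := sInf {d : ℝ | ∃ i, ¬ M.IsOptimal i ∧ d = M.gap i}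

end Bandit

/-- `Δ_min`: the minimal gap over the two tasks. -/
def deltaMin {A : ℕ} (MLo MHi : Bandit A) : ℝ := min MLo.minGap MHi.minGap

/-- Optimal value dominance of the low-tier task over the high-tier task. -/
def OptValueDominance {A : ℕ} (MLo MHi : Bandit A) : Prop :=
  MHi.bestMean - deltaMin MLo MHi / 2 ≤ MLo.bestMean

/-- The tasks are `ε`-close: the optimal values satisfy `μ*_Lo - μ*_Hi ≤ ε` and the optimal arms
coincide. -/
def IsClose {A : ℕ} (ε : ℝ) (MLo MHi : Bandit A) : Prop :=
  MLo.bestMean - MHi.bestMean ≤ ε ∧ ∀ i, MLo.IsOptimal i ↔ MHi.IsOptimal i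

/-! ### The statistics of the algorithm

Iterations are numbered `1, 2, 3, …`; `a s` and `r s` are the arm pulled and the reward observed at
iteration `s`, and the statistics with index `k` use the iterations `1, …, k - 1`. -/

section Statistics

variable {A : ℕ}

/-- `N^k(i)`: the number of pulls of arm `i` before iteration `k`. -/
def pulls (a : ℕ → Fin A) (k : ℕ) (i : Fin A) : ℕ :=
  ((Finset.Ico 1 k).filter (fun s => a s = i)).card

/-- The empirical mean of arm `i` before iteration `k` (`0` if the arm has not been pulled). -/
def empMean (a : ℕ → Fin A) (r : ℕ → ℝ) (k : ℕ) (i : Fin A) : ℝ :=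
  (∑ s ∈ (Finset.Ico 1 k).filter (fun s => a s = i), r s) / (pulls a k i : ℝ)

/-- `f(k) = 1 + 16 A² (k + 1)²`. -/
def fA (A k : ℕ) : ℝ := 1 + 16 * (A : ℝ) ^ 2 * ((k : ℝ) + 1) ^ 2

/-- The confidence width `√(2 α log f(k) / N^k(i))`. -/
def width (α : ℝ) (a : ℕ → Fin A) (k : ℕ) (i : Fin A) : ℝ :=
  Real.sqrt (2 * α * Real.log (fA A k) / (pulls a k i : ℝ))

/-- The upper confidence bound. -/
def ucb (α : ℝ) (a : ℕ → Fin A) (r : ℕ → ℝ) (k : ℕ) (i : Fin A) : ℝ :=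
  empMean a r k i + width α a k i

/-- The lower confidence bound. -/
def lcb (α : ℝ) (a : ℕ → Fin A) (r : ℕ → ℝ) (k : ℕ) (i : Fin A) : ℝ :=
  empMean a r k i - width α a k i

/-- `i` is a maximizer of `u`; ties are broken in an arbitrary way. -/
def IsArgmax (u : Fin A → ℝ) (i : Fin A) : Prop := ∀ j, u j ≤ u i

/-- The checking event at iteration `k`, for the arm `j` that is greedy for the lower confidence
bounds in the low-tier task. -/
def CheckEvent (α ε : ℝ) (aLo aHi : ℕ → Fin A) (rLo rHi : ℕ → ℝ) (k : ℕ) (j : Fin A) : Prop :=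
  lcb α aLo rLo k j ≤ ucb α aHi rHi k j + ε ∧ (k : ℝ) / 2 < (pulls aLo k j : ℝ)

end Statistics

/-! ### Interaction with a task, and the runs of the algorithm -/

section Runs

variable {A : ℕ} {Ω : Type*} [mΩ : MeasurableSpace Ω]

/-- The arms `arm k` and rewards `rew k`, `k = 1, 2, …`, come from interacting with the task `M`.
`F k` is the information available after iteration `k`: the next arm is determined by `F k`
(which may contain internal randomness of the learner), and, given `F k`, the reward of iteration
`k + 1` has the distribution of the arm that is pulled. -/
structure IsInteraction (P : Measure Ω) (F : Filtration ℕ mΩ) (M : Bandit A)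
    (arm : ℕ → Ω → Fin A) (rew : ℕ → Ω → ℝ) : Prop where
  arm_meas : ∀ k, Measurable[F k] (arm (k + 1))
  rew_meas : ∀ k, Measurable[F (k + 1)] (rew (k + 1))
  rew_law : ∀ (k : ℕ) (i : Fin A) (E : Set Ω) (B : Set ℝ),
    MeasurableSet[F k] E → MeasurableSet B →
      P (E ∩ {ω | arm (k + 1) ω = i} ∩ {ω | rew (k + 1) ω ∈ B})
        = P (E ∩ {ω | arm (k + 1) ω = i}) * M.law i B

/-- A run of the robust tiered bandit algorithm with parameters `α` and `ε` on the two tasks, played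
in parallel: `armLo, armHi` are the arms pulled, `rewLo, rewHi` the rewards observed. Nothing is
assumed on the joint law of the two rewards of the same iteration. -/
structure IsTieredRun (α ε : ℝ) (MLo MHi : Bandit A) (P : Measure Ω) (F : Filtration ℕ mΩ)
    (armLo armHi : ℕ → Ω → Fin A) (rewLo rewHi : ℕ → Ω → ℝ) : Prop where
  interactLo : IsInteraction P F MLo armLo rewLo
  interactHi : IsInteraction P F MHi armHi rewHi
  /-- each arm is pulled in the first `A` iterations, in both tasks -/
  initLo : ∀ ω i, ∃ k ∈ Finset.Icc 1 A, armLo k ω = i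
  initHi : ∀ ω i, ∃ k ∈ Finset.Icc 1 A, armHi k ω = i
  /-- the low-tier task is played by UCB -/
  ruleLo : ∀ ω, ∀ k > A, IsArgmax (ucb α (armLo · ω) (rewLo · ω) k) (armLo k ω)
  /-- the high-tier task copies a maximizer `j` of the lower confidence bounds of the low-tier task
  if the checking event holds for it, and plays UCB otherwise -/
  ruleHi : ∀ ω, ∀ k > A, ∃ j : Fin A, IsArgmax (lcb α (armLo · ω) (rewLo · ω) k) j ∧
    (CheckEvent α ε (armLo · ω) (armHi · ω) (rewLo · ω) (rewHi · ω) k j → armHi k ω = j) ∧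
    (¬ CheckEvent α ε (armLo · ω) (armHi · ω) (rewLo · ω) (rewHi · ω) k j →
      IsArgmax (ucb α (armHi · ω) (rewHi · ω) k) (armHi k ω))

/-- The pseudo-regret `E[∑_{k=1}^K (μ* - μ(π^k))]` of the arms `arm` in the task `M`. -/
def regret (P : Measure Ω) (M : Bandit A) (arm : ℕ → Ω → Fin A) (K : ℕ) : ℝ :=
  ∫ ω, ∑ k ∈ Finset.Icc 1 K, (M.bestMean - M.mean (arm k ω)) ∂P

end Runs

open Classical in
/-- `∑_{i : Δ(i) > 0} 1 / Δ(i)`. -/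
def invGapSum {A : ℕ} (M : Bandit A) : ℝ :=
  ∑ i ∈ Finset.univ.filter (fun i => 0 < M.gap i), 1 / M.gap i

end

end TieredMAB

/-! The exponential of the sum of `t (r - μ) - t² / 8` over the pulls of one arm is a
supermartingale, so Hoeffding's inequality holds for the random number of pulls. Hence, outside an
event of probability `O(k⁻²)`, the confidence intervals are valid in the high-tier task at
iteration `k` and in the low-tier task throughout `[k / 4, k]`; the other iterations cost `O(1)` in
total. At such a good iteration an arm pulled by UCB has a gap of at most twice its width. If
instead the arm `j` is copied, then `j` has been pulled more than `k / 2` times in the low-tier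
task, so that its last pull there was a UCB pull at an iteration `s ≥ k / 4`, with a low-tier gap
of the order of the confidence width of `j` in the high-tier task. The checking event and optimal
value dominance carry this over to the high-tier gap. Either way `N(j) Δ(j)² = O(log f(k))`, which
gives the logarithmic regret.

If the tasks are close, then after a number of iterations polynomial in `A / Δ_min` the suboptimal
arms occupy less than half of the low-tier pulls. From then on the copied arm is the common optimal
arm at every good iteration, and only the logarithm of this number enters the bound. -/

namespace TieredMAB

noncomputable section

namespace Bandit

variable {A : ℕ} (M : Bandit A) {i : Fin A}

theorem mean_mem_Icc (i : Fin A) : M.mean i ∈ Set.Icc (0 : ℝ) 1 :=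
  have := M.isProb i
  (convex_Icc 0 1).integral_mem isClosed_Icc (M.mem_Icc i)
    (Integrable.of_mem_Icc 0 1 aemeasurable_id (M.mem_Icc i))

theorem mean_le_bestMean (i : Fin A) : M.mean i ≤ M.bestMean :=
  le_ciSup (Set.finite_range M.mean).bddAbove i

theorem gap_nonneg (i : Fin A) : 0 ≤ M.gap i := sub_nonneg.2 (M.mean_le_bestMean i)

theorem gap_le_one (i : Fin A) : M.gap i ≤ 1 := by
  have : Nonempty (Fin A) := ⟨i⟩
  have hbest : M.bestMean ≤ 1 := ciSup_le fun j => (M.mean_mem_Icc j).2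
  have hmean : 0 ≤ M.mean i := (M.mean_mem_Icc i).1
  unfold gap
  linarith

variable {M}

theorem isOptimal_iff_gap_eq_zero : M.IsOptimal i ↔ M.gap i = 0 := by
  have : Nonempty (Fin A) := ⟨i⟩
  rw [gap, sub_eq_zero]
  exact ⟨fun h => le_antisymm (ciSup_le h) (M.mean_le_bestMean i),
    fun h j => h ▸ M.mean_le_bestMean j⟩

theorem IsOptimal.mean_eq (h : M.IsOptimal i) : M.mean i = M.bestMean :=
  (sub_eq_zero.1 (isOptimal_iff_gap_eq_zero.1 h)).symm

theorem gap_pos_iff_not_isOptimal : 0 < M.gap i ↔ ¬ M.IsOptimal i := by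
  rw [isOptimal_iff_gap_eq_zero, (M.gap_nonneg i).lt_iff_ne']

theorem two_le_of_not_isOptimal (h : ¬ M.IsOptimal i) : 2 ≤ A := by
  simp only [IsOptimal, not_forall, not_le] at h
  obtain ⟨j, hj⟩ := h
  exact Fin.nontrivial_iff_two_le.1 ⟨⟨i, j, fun hij => hj.ne (hij ▸ rfl)⟩⟩

theorem minGap_le (h : ¬ M.IsOptimal i) : M.minGap ≤ M.gap i :=
  csInf_le ⟨0, by rintro _ ⟨j, -, rfl⟩; exact M.gap_nonneg j⟩ ⟨i, h, rfl⟩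

theorem minGap_pos (h : ¬ M.IsOptimal i) : 0 < M.minGap := by
  have hfin : {d : ℝ | ∃ i, ¬ M.IsOptimal i ∧ d = M.gap i}.Finite :=
    (Set.finite_range M.gap).subset (by rintro _ ⟨j, -, rfl⟩; exact ⟨j, rfl⟩)
  have hne : {d : ℝ | ∃ i, ¬ M.IsOptimal i ∧ d = M.gap i}.Nonempty := ⟨_, i, h, rfl⟩
  obtain ⟨j, hj, hmin⟩ := hne.csInf_mem hfin
  rw [minGap, hmin]
  exact gap_pos_iff_not_isOptimal.2 hj

end Bandit

section Pulls

variable {A : ℕ} (a : ℕ → Fin A) {i : Fin A} {k m : ℕ} {B : ℝ}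

theorem pulls_succ (hk : 1 ≤ k) (i : Fin A) :
    pulls a (k + 1) i = pulls a k i + if a k = i then 1 else 0 := by
  unfold pulls
  rw [← Finset.insert_Ico_right_eq_Ico_add_one hk, Finset.filter_insert]
  split_ifs <;> simp

theorem pulls_mono (i : Fin A) : Monotone fun k => pulls a k i := fun _ _ h =>
  Finset.card_le_card (Finset.filter_subset_filter _ (Finset.Ico_subset_Ico_right h))

theorem pulls_lt (hk : 1 ≤ k) (i : Fin A) : pulls a k i < k := by
  have h : pulls a k i ≤ k - 1 := by
    simpa only [pulls, Nat.card_Ico] using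
      Finset.card_filter_le (Finset.Ico 1 k) (fun s => a s = i)
  omega

theorem sum_pulls (k : ℕ) : ∑ i, pulls a k i = k - 1 := by
  simpa [pulls] using (Finset.card_eq_sum_card_fiberwise (s := Finset.Ico 1 k)
    (t := Finset.univ) (f := a) (by simp)).symm

theorem exists_last_pull (h : 0 < pulls a k i) :
    ∃ s, 1 ≤ s ∧ s < k ∧ a s = i ∧ pulls a k i = pulls a s i + 1 := by
  induction k with
  | zero => simp [pulls] at h
  | succ k ih =>
    rcases Nat.eq_zero_or_pos k with rfl | hk
    · simp [pulls] at h
    · rw [pulls_succ a hk] at h ⊢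
      split_ifs at h ⊢ with hi
      · exact ⟨k, hk, by omega, hi, rfl⟩
      · obtain ⟨s, hs1, hsk, hsi, hs⟩ := ih h
        exact ⟨s, hs1, by omega, hsi, hs⟩

theorem pulls_le_max_of_forall_pulls_le
    (h : ∀ s, m ≤ s → s < k → a s = i → (pulls a s i : ℝ) ≤ B) :
    (pulls a k i : ℝ) ≤ max (pulls a m i : ℝ) (B + 1) := by
  rcases Nat.eq_zero_or_pos (pulls a k i) with h0 | hpos
  · simp [h0]
  obtain ⟨s, hs1, hsk, hsi, hlast⟩ := exists_last_pull a hpos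
  rcases Nat.lt_or_ge s m with hsm | hms
  · refine le_max_of_le_left (Nat.cast_le.2 ?_)
    calc pulls a k i = pulls a (s + 1) i := by rw [hlast, pulls_succ a hs1, if_pos hsi]
      _ ≤ pulls a m i := pulls_mono a i hsm
  · refine le_max_of_le_right ?_
    rw [hlast, Nat.cast_add_one]
    linarith [h s hms hsk hsi]

/-- The members of `S` are pulls of `i`, and all of them but the last one are counted in the number
of pulls before the last one. -/
theorem card_le_add_one_of_forall_pulls_le {S : Finset ℕ} (hB : 0 ≤ B)
    (hS : ∀ s ∈ S, 1 ≤ s ∧ a s = i ∧ (pulls a s i : ℝ) ≤ B) : (S.card : ℝ) ≤ B + 1 := by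
  rcases S.eq_empty_or_nonempty with rfl | hne
  · simpa using hB.trans (le_add_of_nonneg_right zero_le_one)
  obtain ⟨hlast1, hlasti, hlastB⟩ := hS _ (S.max'_mem hne)
  have hsub : S ⊆ (Finset.Ico 1 (S.max' hne + 1)).filter fun s => a s = i := fun s hs =>
    Finset.mem_filter.2 ⟨Finset.mem_Ico.2 ⟨(hS s hs).1, Nat.lt_succ_of_le (S.le_max' s hs)⟩,
      (hS s hs).2.1⟩
  have hcard : S.card ≤ pulls a (S.max' hne + 1) i := Finset.card_le_card hsub
  rw [pulls_succ a hlast1, if_pos hlasti] at hcard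
  calc (S.card : ℝ) ≤ pulls a (S.max' hne) i + 1 := by exact_mod_cast hcard
    _ ≤ B + 1 := by gcongr

theorem le_pulls_add_of_forall_ne_pulls_le (hB : 0 ≤ B) (hm : 1 ≤ m)
    (h : ∀ j, j ≠ i → (pulls a k j : ℝ) ≤ pulls a m j + B) :
    (k : ℝ) ≤ pulls a k i + m + A * B := by
  have hk : (k : ℝ) ≤ ∑ j, (pulls a k j : ℝ) + 1 := by
    rw [← Nat.cast_sum, sum_pulls]
    exact_mod_cast Nat.le_add_of_sub_le le_rfl
  have hm' : ∑ j, (pulls a m j : ℝ) = m - 1 := by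
    rw [← Nat.cast_sum, sum_pulls, Nat.cast_sub hm, Nat.cast_one]
  have hne : ∑ j ∈ Finset.univ.erase i, (pulls a k j : ℝ) ≤ m - 1 + A * B :=
    calc ∑ j ∈ Finset.univ.erase i, (pulls a k j : ℝ)
        ≤ ∑ j ∈ Finset.univ.erase i, (pulls a m j + B) :=
          Finset.sum_le_sum fun j hj => h j (Finset.ne_of_mem_erase hj)
      _ ≤ ∑ j, (pulls a m j + B) :=
          Finset.sum_le_sum_of_subset_of_nonneg (Finset.erase_subset _ _)
            fun j _ _ => by positivity
      _ = m - 1 + A * B := by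
          rw [Finset.sum_add_distrib, hm', Finset.sum_const, Finset.card_fin, nsmul_eq_mul]
  rw [← Finset.add_sum_erase _ _ (Finset.mem_univ i)] at hk
  linarith

variable {a}

theorem pulls_pos_of_init (h : ∀ i, ∃ k ∈ Finset.Icc 1 A, a k = i) (hk : A < k) (i : Fin A) :
    0 < pulls a k i := by
  obtain ⟨s, hs, rfl⟩ := h i
  rw [Finset.mem_Icc] at hs
  exact Finset.card_pos.2 ⟨s, Finset.mem_filter.2 ⟨Finset.mem_Ico.2 (by omega), rfl⟩⟩

theorem pulls_eq_zero_of_init (h : ∀ i, ∃ k ∈ Finset.Icc 1 A, a k = i) (hk : k ≤ A) :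
    pulls a k (a k) = 0 := by
  have hinj : Set.InjOn a (Finset.Icc 1 A) :=
    Finset.injOn_of_surjOn_of_card_le (t := Finset.univ) a (by simp [Set.MapsTo])
      (fun i _ => h i) (by simp)
  unfold pulls
  rw [Finset.card_eq_zero, Finset.filter_eq_empty_iff]
  intro s hs heq
  rw [Finset.mem_Ico] at hs
  have : s = k := hinj (Finset.mem_Icc.2 (by omega)) (Finset.mem_Icc.2 (by omega)) heq
  omega

end Pulls

section Widths

variable {A : ℕ} {α : ℝ} {a b : ℕ → Fin A} {i j : Fin A} {k l : ℕ}

theorem one_le_fA (A k : ℕ) : 1 ≤ fA A k :=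
  le_add_of_nonneg_right (by positivity)

theorem log_fA_nonneg (A k : ℕ) : 0 ≤ Real.log (fA A k) := Real.log_nonneg (one_le_fA A k)

theorem log_fA_mono (A : ℕ) (h : k ≤ l) : Real.log (fA A k) ≤ Real.log (fA A l) := by
  apply Real.log_le_log (zero_lt_one.trans_le (one_le_fA A k))
  unfold fA
  gcongr

theorem log_fA_le (hA : A ≤ k) (hk : 2 ≤ k) : Real.log (fA A k) ≤ 10 * Real.log k := by
  have hk' : (2 : ℝ) ≤ k := by exact_mod_cast hk
  have hpow : fA A k ≤ (k : ℝ) ^ 10 := by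
    calc fA A k ≤ 1 + 16 * (k : ℝ) ^ 2 * (3 / 2 * k) ^ 2 := by
          unfold fA
          gcongr
          linarith
      _ = 1 + 36 * (k : ℝ) ^ 4 := by ring
      _ ≤ 2 ^ 6 * (k : ℝ) ^ 4 := by linarith [one_le_pow₀ (n := 4) (by linarith : (1 : ℝ) ≤ k)]
      _ ≤ (k : ℝ) ^ 6 * (k : ℝ) ^ 4 := by gcongr
      _ = (k : ℝ) ^ 10 := by ring
  calc Real.log (fA A k) ≤ Real.log ((k : ℝ) ^ 10) :=
        Real.log_le_log (zero_lt_one.trans_le (one_le_fA A k)) hpow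
    _ = 10 * Real.log k := by rw [Real.log_pow]; norm_num

theorem width_sq_mul_pulls (hα : 0 ≤ α) (hi : 0 < pulls a k i) :
    width α a k i ^ 2 * pulls a k i = 2 * α * Real.log (fA A k) := by
  have hn : (0 : ℝ) < pulls a k i := Nat.cast_pos.2 hi
  have hlog := log_fA_nonneg A k
  rw [width, Real.sq_sqrt (by positivity), div_mul_cancel₀ _ hn.ne']

theorem width_le_mul_width {c : ℝ} (hα : 0 ≤ α) (hkl : k ≤ l) (hc : 0 ≤ c)
    (hj : 0 < pulls b l j) (h : (pulls b l j : ℝ) ≤ c ^ 2 * pulls a k i) :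
    width α a k i ≤ c * width α b l j := by
  have hN : (0 : ℝ) < pulls b l j := Nat.cast_pos.2 hj
  have hn : (0 : ℝ) < pulls a k i := pos_of_mul_pos_right (hN.trans_le h) (sq_nonneg c)
  have hlog := log_fA_nonneg A l
  have hlog_mono := log_fA_mono A hkl
  unfold width
  rw [← Real.sqrt_sq hc, ← Real.sqrt_mul (sq_nonneg c), mul_div_assoc']
  apply Real.sqrt_le_sqrt
  rw [div_le_div_iff₀ hn hN]
  calc 2 * α * Real.log (fA A k) * pulls b l j
      ≤ 2 * α * Real.log (fA A l) * (c ^ 2 * pulls a k i) := by gcongr 2 * α * ?_ * ?_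
    _ = c ^ 2 * (2 * α * Real.log (fA A l)) * pulls a k i := by ring

theorem pulls_mul_sq_le_of_le_mul_width {c x : ℝ} (hα : 0 ≤ α) (hi : 0 < pulls a k i)
    (hx : 0 ≤ x) (h : x ≤ c * width α a k i) :
    pulls a k i * x ^ 2 ≤ 2 * c ^ 2 * α * Real.log (fA A k) := by
  calc pulls a k i * x ^ 2 ≤ pulls a k i * (c * width α a k i) ^ 2 := by gcongr
    _ = c ^ 2 * (width α a k i ^ 2 * pulls a k i) := by ring
    _ = 2 * c ^ 2 * α * Real.log (fA A k) := by rw [width_sq_mul_pulls hα hi]; ring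

end Widths

/-- The confidence intervals before iteration `k` contain the means, for all arms pulled so far. -/
def Concentrated {A : ℕ} (α : ℝ) (M : Bandit A) (a : ℕ → Fin A) (r : ℕ → ℝ) (k : ℕ) : Prop :=
  ∀ i, 0 < pulls a k i → |empMean a r k i - M.mean i| ≤ width α a k i

/-- The confidence intervals are valid throughout the iterations from `k / 4` to `k`. The window is
long enough to contain a pull of any arm that has been pulled more than `k / 2` times. -/
def RecentlyConcentrated {A : ℕ} (α : ℝ) (M : Bandit A) (a : ℕ → Fin A) (r : ℕ → ℝ) (k : ℕ) :
    Prop :=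
  ∀ s ≤ k, k ≤ 4 * s → Concentrated α M a r s

/-- A path of arms and rewards played by UCB after each arm has been pulled once. -/
structure IsUCBPath {A : ℕ} (α : ℝ) (a : ℕ → Fin A) (r : ℕ → ℝ) : Prop where
  init : ∀ i, ∃ k ∈ Finset.Icc 1 A, a k = i
  rule : ∀ k > A, IsArgmax (ucb α a r k) (a k)

section Concentration

variable {A : ℕ} {α : ℝ} {M : Bandit A} {a : ℕ → Fin A} {r : ℕ → ℝ} {k : ℕ} {i j : Fin A}

namespace Concentrated

theorem mean_le_ucb (h : Concentrated α M a r k) (hi : 0 < pulls a k i) :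
    M.mean i ≤ ucb α a r k i := by
  have := (abs_le.1 (h i hi)).1
  unfold ucb
  linarith

theorem ucb_le_mean_add (h : Concentrated α M a r k) (hi : 0 < pulls a k i) :
    ucb α a r k i ≤ M.mean i + 2 * width α a k i := by
  have := (abs_le.1 (h i hi)).2
  unfold ucb
  linarith

theorem lcb_le_mean (h : Concentrated α M a r k) (hi : 0 < pulls a k i) :
    lcb α a r k i ≤ M.mean i := by
  have := (abs_le.1 (h i hi)).2
  unfold lcb
  linarith

theorem mean_sub_le_lcb (h : Concentrated α M a r k) (hi : 0 < pulls a k i) :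
    M.mean i - 2 * width α a k i ≤ lcb α a r k i := by
  have := (abs_le.1 (h i hi)).1
  unfold lcb
  linarith

theorem gap_le_of_isArgmax_ucb (h : Concentrated α M a r k) (hpos : ∀ i, 0 < pulls a k i)
    (hi : IsArgmax (ucb α a r k) i) : M.gap i ≤ 2 * width α a k i := by
  have : Nonempty (Fin A) := ⟨i⟩
  have hbest : M.bestMean ≤ ucb α a r k i :=
    ciSup_le fun j => (h.mean_le_ucb (hpos j)).trans (hi j)
  have hucb := h.ucb_le_mean_add (hpos i)
  unfold Bandit.gap
  linarith

theorem gap_le_of_isArgmax_lcb (h : Concentrated α M a r k) (hi : 0 < pulls a k i)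
    (hj : 0 < pulls a k j) (hopt : M.IsOptimal i) (hmax : IsArgmax (lcb α a r k) j) :
    M.gap j ≤ 2 * width α a k i := by
  have hlcb := (h.mean_sub_le_lcb hi).trans ((hmax i).trans (h.lcb_le_mean hj))
  rw [hopt.mean_eq] at hlcb
  unfold Bandit.gap
  linarith

end Concentrated

end Concentration

section Path

variable {A : ℕ} {α ε : ℝ} {M MLo MHi : Bandit A} {a aLo aHi : ℕ → Fin A} {r rLo rHi : ℕ → ℝ}
  {i j : Fin A} {k : ℕ}

theorem IsUCBPath.pulls_mul_gap_sq_le (h : IsUCBPath α a r) (hα : 0 ≤ α)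
    (hconc : Concentrated α M a r k) :
    pulls a k (a k) * M.gap (a k) ^ 2 ≤ 8 * α * Real.log (fA A k) := by
  have hlog := log_fA_nonneg A k
  rcases Nat.lt_or_ge A k with hk | hk
  · have hpos := pulls_pos_of_init h.init hk
    refine (pulls_mul_sq_le_of_le_mul_width hα (hpos _) (M.gap_nonneg _)
      (hconc.gap_le_of_isArgmax_ucb hpos (h.rule k hk))).trans_eq (by ring)
  · rw [pulls_eq_zero_of_init h.init hk, Nat.cast_zero, zero_mul]
    positivity

theorem IsUCBPath.exists_recent_pull (h : IsUCBPath α a r) (hk : 2 ≤ k)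
    (hj : (k : ℝ) / 2 < pulls a k j) :
    ∃ s, A < s ∧ s < k ∧ k ≤ 4 * s ∧ a s = j ∧ (k : ℝ) ≤ 4 * pulls a s j := by
  have hj' : k < 2 * pulls a k j := by
    have : (k : ℝ) < 2 * pulls a k j := by linarith
    exact_mod_cast this
  obtain ⟨s, hs1, hsk, hsj, hlast⟩ := exists_last_pull a (by omega : 0 < pulls a k j)
  have hpulls : k ≤ 4 * pulls a s j := by omega
  refine ⟨s, ?_, hsk, ?_, hsj, by exact_mod_cast hpulls⟩
  · by_contra hs
    have := pulls_eq_zero_of_init h.init (not_lt.1 hs)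
    rw [hsj] at this
    omega
  · have := pulls_lt a hs1 j
    omega

/-- The low-tier gap of `j` is controlled at the last low-tier pull of `j`, and all the low-tier
widths involved are at most twice the high-tier one. -/
theorem gap_le_of_checkEvent (hLo : IsUCBPath α aLo rLo) (hα : 0 ≤ α) (hkA : A < k)
    (hconcLo : RecentlyConcentrated α MLo aLo rLo k) (hconcHi : Concentrated α MHi aHi rHi k)
    (hj : 0 < pulls aHi k j) (hcheck : CheckEvent α ε aLo aHi rLo rHi k j) :
    MHi.gap j ≤ MHi.bestMean - MLo.bestMean + ε + 10 * width α aHi k j := by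
  have hA : 0 < A := j.pos
  have hHi : (pulls aHi k j : ℝ) ≤ k := by exact_mod_cast (pulls_lt aHi (by omega) j).le
  obtain ⟨s, hAs, hsk, hks, hsj, hpulls⟩ := hLo.exists_recent_pull (by omega) hcheck.2
  have hwidth_s : width α aLo s j ≤ 2 * width α aHi k j :=
    width_le_mul_width hα hsk.le zero_le_two hj (by linarith)
  have hwidth_k : width α aLo k j ≤ 2 * width α aHi k j :=
    width_le_mul_width hα le_rfl zero_le_two hj (by linarith [hcheck.2])
  have hgapLo : MLo.gap j ≤ 2 * width α aLo s j :=
    (hconcLo s hsk.le hks).gap_le_of_isArgmax_ucb (pulls_pos_of_init hLo.init hAs)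
      (hsj ▸ hLo.rule s hAs)
  have hlcb := (hconcLo k le_rfl (by omega)).mean_sub_le_lcb (pulls_pos_of_init hLo.init hkA j)
  have hucb := hconcHi.ucb_le_mean_add hj
  have hle := hcheck.1
  unfold Bandit.gap at hgapLo ⊢
  linarith

theorem gap_le_of_checkEvent_of_optValueDominance (hovd : OptValueDominance MLo MHi)
    (hε : ε ≤ deltaMin MLo MHi / 4) (hLo : IsUCBPath α aLo rLo) (hα : 0 ≤ α) (hkA : A < k)
    (hconcLo : RecentlyConcentrated α MLo aLo rLo k) (hconcHi : Concentrated α MHi aHi rHi k)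
    (hj : 0 < pulls aHi k j) (hcheck : CheckEvent α ε aLo aHi rLo rHi k j) :
    MHi.gap j ≤ 40 * width α aHi k j := by
  by_cases hopt : MHi.IsOptimal j
  · rw [Bandit.isOptimal_iff_gap_eq_zero.1 hopt]
    exact mul_nonneg (by norm_num) (Real.sqrt_nonneg _)
  have hmin : deltaMin MLo MHi ≤ MHi.gap j := (min_le_right _ _).trans (Bandit.minGap_le hopt)
  have hgap := gap_le_of_checkEvent hLo hα hkA hconcLo hconcHi hj hcheck
  unfold OptValueDominance at hovd
  linarith

/-- At most `k / 4` of the pulls precede the recent window, in which an arm `j ≠ i` is pulled only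
while its number of pulls is small. -/
theorem IsUCBPath.half_lt_pulls (h : IsUCBPath α a r) (hα : 0 ≤ α)
    (hconc : RecentlyConcentrated α M a r k) {Δ : ℝ} (hΔ : 0 < Δ)
    (hi : ∀ j, j ≠ i → Δ ≤ M.gap j)
    (hk : 8 * A * (1 + 4 * (α * Real.log (fA A k) / Δ ^ 2)) < k) :
    (k : ℝ) / 2 < pulls a k i := by
  set B : ℝ := α * Real.log (fA A k) / Δ ^ 2 with hB
  have hlog := log_fA_nonneg A k
  have hA : (1 : ℝ) ≤ A := by exact_mod_cast i.pos
  have hwindow : ∀ j, j ≠ i → (pulls a k j : ℝ) ≤ pulls a (k / 4 + 1) j + (8 * B + 1) := by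
    intro j hj
    refine (pulls_le_max_of_forall_pulls_le a (B := 8 * B) fun s hms hsk hsj => ?_).trans
      (max_le_add_of_nonneg (Nat.cast_nonneg _) (by positivity))
    have hs := h.pulls_mul_gap_sq_le hα (hconc s hsk.le (by omega))
    rw [hsj] at hs
    have hlog_mono := log_fA_mono A hsk.le
    have hgap := hi j hj
    rw [hB, mul_div_assoc', le_div_iff₀ (by positivity)]
    calc pulls a s j * Δ ^ 2 ≤ pulls a s j * M.gap j ^ 2 := by gcongr
      _ ≤ 8 * α * Real.log (fA A s) := hs
      _ ≤ 8 * α * Real.log (fA A k) := by gcongr 8 * α * ?_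
      _ = 8 * (α * Real.log (fA A k)) := mul_assoc _ _ _
  have hsum := le_pulls_add_of_forall_ne_pulls_le a (by positivity) (by omega) hwindow
  have hdiv : ((k / 4 + 1 : ℕ) : ℝ) ≤ k / 4 + 1 := by
    rw [Nat.cast_add_one]
    gcongr
    exact Nat.cast_div_le
  linarith

theorem IsUCBPath.eq_of_isArgmax_lcb (h : IsUCBPath α a r) (hα : 0 ≤ α) (hkA : A < k)
    (hconc : RecentlyConcentrated α M a r k) {Δ : ℝ} (hΔ : 0 < Δ) (hopt : M.IsOptimal i)
    (hi : ∀ j, j ≠ i → Δ ≤ M.gap j)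
    (hk : 8 * A * (1 + 4 * (α * Real.log (fA A k) / Δ ^ 2)) < k)
    (hmax : IsArgmax (lcb α a r k) j) : j = i := by
  by_contra hji
  have hpos := pulls_pos_of_init h.init hkA
  have hlog := log_fA_nonneg A k
  have hA : (1 : ℝ) ≤ A := by exact_mod_cast i.pos
  have hgap : Δ ≤ 2 * width α a k i := (hi j hji).trans
    ((hconc k le_rfl (by omega)).gap_le_of_isArgmax_lcb (hpos i) (hpos j) hopt hmax)
  have hhalf := h.half_lt_pulls hα hconc hΔ hi hk
  have hpulls : (pulls a k i : ℝ) ≤ 8 * (α * Real.log (fA A k) / Δ ^ 2) := by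
    rw [mul_div_assoc', le_div_iff₀ (by positivity)]
    exact (pulls_mul_sq_le_of_le_mul_width hα (hpos i) hΔ.le hgap).trans_eq (by ring)
  have hlarge : 8 * (1 + 4 * (α * Real.log (fA A k) / Δ ^ 2)) < k :=
    lt_of_le_of_lt (by gcongr; linarith) hk
  linarith

end Path

section ExponentialMoments

theorem lintegral_mul_comp_of_measure_inter_preimage_eq {Ω E : Type*} [MeasurableSpace E]
    {m mΩ : MeasurableSpace Ω} (hm : m ≤ mΩ) {Q : Measure Ω} {ν : Measure E} {X : Ω → E}
    (hX : Measurable X)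
    (h : ∀ S B, MeasurableSet[m] S → MeasurableSet B → Q (S ∩ X ⁻¹' B) = Q S * ν B)
    {W : Ω → ENNReal} (hW : Measurable[m] W) {g : E → ENNReal} (hg : Measurable g) :
    ∫⁻ ω, W ω * g (X ω) ∂Q = (∫⁻ ω, W ω ∂Q) * ∫⁻ x, g x ∂ν := by
  have htrim : ∀ B, MeasurableSet B → (Q.restrict (X ⁻¹' B)).trim hm = ν B • Q.trim hm := by
    refine fun B hB => @Measure.ext _ m _ _ fun S hS => ?_
    rw [Measure.smul_apply, trim_measurableSet_eq hm hS, trim_measurableSet_eq hm hS,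
      Measure.restrict_apply (hm S hS), h S B hS hB, smul_eq_mul, mul_comm]
  have hmap : (Q.withDensity W).map X = (∫⁻ ω, W ω ∂Q) • ν := by
    ext B hB
    rw [Measure.map_apply hX hB, withDensity_apply _ (hX hB), ← lintegral_trim hm hW,
      htrim B hB, lintegral_smul_measure, lintegral_trim hm hW, Measure.smul_apply, smul_eq_mul,
      smul_eq_mul, mul_comm]
  calc ∫⁻ ω, W ω * g (X ω) ∂Q = ∫⁻ ω, g (X ω) ∂Q.withDensity W :=
        (lintegral_withDensity_eq_lintegral_mul _ (hW.mono hm le_rfl) (hg.comp hX)).symm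
    _ = ∫⁻ x, g x ∂(Q.withDensity W).map X := (lintegral_map hg hX).symm
    _ = (∫⁻ ω, W ω ∂Q) * ∫⁻ x, g x ∂ν := by rw [hmap, lintegral_smul_measure, smul_eq_mul]

theorem lintegral_exp_sub_le_one_of_hasSubgaussianMGF {Ω : Type*} [MeasurableSpace Ω]
    {μ : Measure Ω} {X : Ω → ℝ} {c : NNReal} (h : HasSubgaussianMGF X c μ) (t : ℝ) :
    ∫⁻ ω, ENNReal.ofReal (Real.exp (t * X ω - c * t ^ 2 / 2)) ∂μ ≤ 1 := by
  simp_rw [Real.exp_sub]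
  rw [← ofReal_integral_eq_lintegral_ofReal ((h.integrable_exp_mul t).div_const _)
    (Filter.Eventually.of_forall fun ω => by positivity), integral_div, ENNReal.ofReal_le_one]
  exact div_le_one_of_le₀ (h.mgf_le t) (Real.exp_pos _).le

theorem Bandit.lintegral_exp_le_one {A : ℕ} (M : Bandit A) (i : Fin A) (t : ℝ) :
    ∫⁻ x, ENNReal.ofReal (Real.exp (t * (x - M.mean i) - t ^ 2 / 8)) ∂(M.law i) ≤ 1 := by
  have := M.isProb i
  have hsub := hasSubgaussianMGF_of_mem_Icc (μ := M.law i) (X := fun x => x) (a := 0) (b := 1)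
    aemeasurable_id (M.mem_Icc i)
  refine (lintegral_congr fun x => ?_).trans_le
    (lintegral_exp_sub_le_one_of_hasSubgaussianMGF hsub t)
  congr 3
  norm_num
  ring

end ExponentialMoments

section Hoeffding

variable {A : ℕ}

/-- The exponent of Hoeffding's supermartingale for the rewards of the arm `i`, with parameter `t`,
evaluated at the pulls before iteration `k`. -/
def hoeffdingExponent (M : Bandit A) (i : Fin A) (t : ℝ) (a : ℕ → Fin A) (r : ℕ → ℝ) (k : ℕ) : ℝ :=
  ∑ s ∈ Finset.Ico 1 k, if a s = i then t * (r s - M.mean i) - t ^ 2 / 8 else 0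

variable {M : Bandit A} {a : ℕ → Fin A} {r : ℕ → ℝ} {i : Fin A} {k : ℕ}

theorem hoeffdingExponent_succ (hk : 1 ≤ k) (t : ℝ) :
    hoeffdingExponent M i t a r (k + 1) = hoeffdingExponent M i t a r k +
      if a k = i then t * (r k - M.mean i) - t ^ 2 / 8 else 0 :=
  Finset.sum_Ico_succ_top hk _

theorem hoeffdingExponent_eq (t : ℝ) (h : 0 < pulls a k i) :
    hoeffdingExponent M i t a r k
      = pulls a k i * (t * (empMean a r k i - M.mean i) - t ^ 2 / 8) := by
  have hpulls : (pulls a k i : ℝ) ≠ 0 := by exact_mod_cast h.ne'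
  have hrewards : ∑ s ∈ (Finset.Ico 1 k).filter (fun s => a s = i), r s
      = pulls a k i * empMean a r k i := (mul_div_cancel₀ _ hpulls).symm
  rw [hoeffdingExponent, ← Finset.sum_filter, Finset.sum_sub_distrib, ← Finset.mul_sum,
    Finset.sum_sub_distrib, hrewards, Finset.sum_const, Finset.sum_const, ← pulls, nsmul_eq_mul,
    nsmul_eq_mul]
  ring

/-- The parameters `t = ± 4 w` give the exponent `n (4 w² - 2 w²)`. -/
theorem le_hoeffdingExponent_or {w : ℝ} (h : 0 < pulls a k i) (hw : 0 ≤ w)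
    (hdev : w ≤ |empMean a r k i - M.mean i|) :
    2 * pulls a k i * w ^ 2 ≤ hoeffdingExponent M i (4 * w) a r k ∨
      2 * pulls a k i * w ^ 2 ≤ hoeffdingExponent M i (-(4 * w)) a r k := by
  have hexponent : ∀ x, w ≤ x →
      2 * pulls a k i * w ^ 2 ≤ pulls a k i * (4 * w * x - (4 * w) ^ 2 / 8) := by
    intro x hx
    calc 2 * pulls a k i * w ^ 2 = pulls a k i * (4 * w * w - (4 * w) ^ 2 / 8) := by ring
      _ ≤ pulls a k i * (4 * w * x - (4 * w) ^ 2 / 8) := by gcongr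
  rw [hoeffdingExponent_eq _ h, hoeffdingExponent_eq _ h, neg_mul, ← mul_neg, neg_sq]
  exact (le_abs.1 hdev).imp (hexponent _) (hexponent _)

variable {Ω : Type*} [mΩ : MeasurableSpace Ω] {P : Measure Ω} {F : Filtration ℕ mΩ}
  {arm : ℕ → Ω → Fin A} {rew : ℕ → Ω → ℝ}

namespace IsInteraction

theorem measurable_arm (h : IsInteraction P F M arm rew) (hk : 1 ≤ k) :
    Measurable[F (k - 1)] (arm k) := by
  obtain ⟨l, rfl⟩ := Nat.exists_eq_add_of_le' hk
  exact h.arm_meas l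

theorem measurable_rew (h : IsInteraction P F M arm rew) (hk : 1 ≤ k) :
    Measurable[F k] (rew k) := by
  obtain ⟨l, rfl⟩ := Nat.exists_eq_add_of_le' hk
  exact h.rew_meas l

theorem measurable_hoeffdingExponent (h : IsInteraction P F M arm rew) (i : Fin A) (t : ℝ)
    (k : ℕ) : Measurable[F k] fun ω => hoeffdingExponent M i t (arm · ω) (rew · ω) (k + 1) := by
  unfold hoeffdingExponent
  refine @Finset.measurable_fun_sum _ _ _ _ _ _ (F k) _ _ fun s hs => ?_
  rw [Finset.mem_Ico] at hs
  have hrew : Measurable[F k] (rew s) :=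
    (h.measurable_rew hs.1).mono (F.mono (Nat.lt_succ_iff.1 hs.2)) le_rfl
  exact Measurable.ite (m := F k)
    (F.mono (by omega) _ (h.measurable_arm hs.1 (measurableSet_singleton i)))
    ((((measurable_id.sub_const _).const_mul t).sub_const _).comp hrew) measurable_const

theorem setLIntegral_mul_comp_rew (h : IsInteraction P F M arm rew) (k : ℕ)
    (i : Fin A) {W : Ω → ENNReal} (hW : Measurable[F k] W) {g : ℝ → ENNReal} (hg : Measurable g) :
    ∫⁻ ω in {ω | arm (k + 1) ω = i}, W ω * g (rew (k + 1) ω) ∂P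
      = (∫⁻ ω in {ω | arm (k + 1) ω = i}, W ω ∂P) * ∫⁻ x, g x ∂(M.law i) := by
  have hrew : Measurable (rew (k + 1)) := (h.rew_meas k).mono (F.le _) le_rfl
  refine lintegral_mul_comp_of_measure_inter_preimage_eq (F.le k) hrew (fun S B hS hB => ?_) hW hg
  rw [Measure.restrict_apply ((F.le k S hS).inter (hrew hB)), Measure.restrict_apply (F.le k S hS),
    Set.inter_right_comm]
  exact h.rew_law k i S B hS hB

/-- On the event that arm `i` is pulled the exponential gains a factor of conditional mean at most
`1`; elsewhere it does not change. -/
theorem lintegral_exp_hoeffdingExponent_succ_le (h : IsInteraction P F M arm rew) (i : Fin A)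
    (t : ℝ) (k : ℕ) :
    ∫⁻ ω, ENNReal.ofReal (Real.exp (hoeffdingExponent M i t (arm · ω) (rew · ω) (k + 2))) ∂P
      ≤ ∫⁻ ω,
          ENNReal.ofReal (Real.exp (hoeffdingExponent M i t (arm · ω) (rew · ω) (k + 1))) ∂P := by
  set W : Ω → ENNReal := fun ω =>
    ENNReal.ofReal (Real.exp (hoeffdingExponent M i t (arm · ω) (rew · ω) (k + 1)))
  set g : ℝ → ENNReal := fun x => ENNReal.ofReal (Real.exp (t * (x - M.mean i) - t ^ 2 / 8))
  have hW : Measurable[F k] W := (ENNReal.measurable_ofReal.comp Real.measurable_exp).comp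
    (h.measurable_hoeffdingExponent i t k)
  have hg : Measurable g := by fun_prop
  have hE : MeasurableSet {ω | arm (k + 1) ω = i} :=
    F.le k _ (h.arm_meas k (measurableSet_singleton i))
  rw [← lintegral_add_compl _ hE, ← lintegral_add_compl W hE]
  gcongr ?_ + ?_
  · calc _ = ∫⁻ ω in {ω | arm (k + 1) ω = i}, W ω * g (rew (k + 1) ω) ∂P := by
          refine setLIntegral_congr_fun hE fun ω (hω : arm (k + 1) ω = i) => ?_
          rw [hoeffdingExponent_succ (by omega), if_pos hω, Real.exp_add,
            ENNReal.ofReal_mul (Real.exp_pos _).le]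
      _ = (∫⁻ ω in {ω | arm (k + 1) ω = i}, W ω ∂P) * ∫⁻ x, g x ∂(M.law i) :=
          h.setLIntegral_mul_comp_rew k i hW hg
      _ ≤ ∫⁻ ω in {ω | arm (k + 1) ω = i}, W ω ∂P :=
          mul_le_of_le_one_right' (M.lintegral_exp_le_one i t)
  · refine (setLIntegral_congr_fun hE.compl fun ω (hω : ¬ arm (k + 1) ω = i) => ?_).le
    rw [hoeffdingExponent_succ (by omega), if_neg hω, add_zero]

theorem lintegral_exp_hoeffdingExponent_le_one [IsProbabilityMeasure P]
    (h : IsInteraction P F M arm rew) (i : Fin A) (t : ℝ) (k : ℕ) :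
    ∫⁻ ω, ENNReal.ofReal (Real.exp (hoeffdingExponent M i t (arm · ω) (rew · ω) (k + 1))) ∂P
      ≤ 1 := by
  induction k with
  | zero => simp [hoeffdingExponent]
  | succ k ih => exact (h.lintegral_exp_hoeffdingExponent_succ_le i t k).trans ih

theorem measureReal_le_hoeffdingExponent_le [IsProbabilityMeasure P]
    (h : IsInteraction P F M arm rew) (i : Fin A) (t c : ℝ) (hk : 1 ≤ k) :
    P.real {ω | c ≤ hoeffdingExponent M i t (arm · ω) (rew · ω) k} ≤ Real.exp (-c) := by
  obtain ⟨l, rfl⟩ := Nat.exists_eq_add_of_le' hk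
  set W : Ω → ENNReal := fun ω =>
    ENNReal.ofReal (Real.exp (hoeffdingExponent M i t (arm · ω) (rew · ω) (l + 1)))
  have hW : Measurable W := (ENNReal.measurable_ofReal.comp Real.measurable_exp).comp
    ((h.measurable_hoeffdingExponent i t l).mono (F.le l) le_rfl)
  have hmarkov : ENNReal.ofReal (Real.exp c) * P {ω | ENNReal.ofReal (Real.exp c) ≤ W ω} ≤ 1 :=
    (mul_meas_ge_le_lintegral hW _).trans (h.lintegral_exp_hoeffdingExponent_le_one i t l)
  refine ENNReal.toReal_le_of_le_ofReal (Real.exp_pos _).le ?_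
  rw [Real.exp_neg, ENNReal.ofReal_inv_of_pos (Real.exp_pos c), ENNReal.le_inv_iff_mul_le, mul_comm]
  refine le_trans (mul_le_mul_right ?_ _) hmarkov
  exact measure_mono fun ω hω => ENNReal.ofReal_le_ofReal (Real.exp_le_exp.2 hω)

theorem measureReal_pulls_eq_and_le_abs_le [IsProbabilityMeasure P]
    (h : IsInteraction P F M arm rew) (i : Fin A) (hk : 1 ≤ k) {n : ℕ} (hn : 1 ≤ n) {w : ℝ}
    (hw : 0 ≤ w) :
    P.real {ω | pulls (arm · ω) k i = n ∧ w ≤ |empMean (arm · ω) (rew · ω) k i - M.mean i|}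
      ≤ 2 * Real.exp (-(2 * n * w ^ 2)) := by
  have hsub : {ω | pulls (arm · ω) k i = n ∧ w ≤ |empMean (arm · ω) (rew · ω) k i - M.mean i|} ⊆
      {ω | 2 * n * w ^ 2 ≤ hoeffdingExponent M i (4 * w) (arm · ω) (rew · ω) k} ∪
        {ω | 2 * n * w ^ 2 ≤ hoeffdingExponent M i (-(4 * w)) (arm · ω) (rew · ω) k} := by
    rintro ω ⟨rfl, hdev⟩
    exact le_hoeffdingExponent_or (Nat.pos_of_ne_zero (Nat.one_le_iff_ne_zero.1 hn)) hw hdev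
  calc _ ≤ _ := measureReal_mono hsub
    _ ≤ _ := measureReal_union_le _ _
    _ ≤ Real.exp (-(2 * n * w ^ 2)) + Real.exp (-(2 * n * w ^ 2)) :=
        add_le_add (h.measureReal_le_hoeffdingExponent_le i _ _ hk)
          (h.measureReal_le_hoeffdingExponent_le i _ _ hk)
    _ = 2 * Real.exp (-(2 * n * w ^ 2)) := (two_mul _).symm

theorem measureReal_not_concentrated_le [IsProbabilityMeasure P] (h : IsInteraction P F M arm rew)
    {α : ℝ} (hα : 0 ≤ α) (hk : 1 ≤ k) :
    P.real {ω | ¬ Concentrated α M (arm · ω) (rew · ω) k}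
      ≤ 2 * A * k * Real.exp (-(4 * α * Real.log (fA A k))) := by
  set w : ℕ → ℝ := fun n => Real.sqrt (2 * α * Real.log (fA A k) / n)
  set S : Fin A → ℕ → Set Ω := fun i n =>
    {ω | pulls (arm · ω) k i = n ∧ w n ≤ |empMean (arm · ω) (rew · ω) k i - M.mean i|}
  have hlog := log_fA_nonneg A k
  have hS : ∀ i, ∀ n ∈ Finset.Ico 1 k,
      P.real (S i n) ≤ 2 * Real.exp (-(4 * α * Real.log (fA A k))) := by
    intro i n hn
    have hn1 := (Finset.mem_Ico.1 hn).1
    refine (h.measureReal_pulls_eq_and_le_abs_le i hk hn1 (Real.sqrt_nonneg _)).trans_eq ?_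
    rw [Real.sq_sqrt (by positivity)]
    congr 3
    field_simp
    ring
  have hsub : {ω | ¬ Concentrated α M (arm · ω) (rew · ω) k} ⊆
      ⋃ p ∈ Finset.univ ×ˢ Finset.Ico 1 k, S p.1 p.2 := by
    intro ω hω
    simp only [Concentrated, Set.mem_ofPred_eq, not_forall, not_le] at hω
    obtain ⟨i, hpos, hlt⟩ := hω
    simp only [Set.mem_iUnion]
    exact ⟨(i, _), Finset.mem_product.2 ⟨Finset.mem_univ i,
      Finset.mem_Ico.2 ⟨hpos, pulls_lt _ hk i⟩⟩, rfl, hlt.le⟩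
  calc _ ≤ _ := measureReal_mono hsub (measure_ne_top _ _)
    _ ≤ ∑ p ∈ Finset.univ ×ˢ Finset.Ico 1 k, P.real (S p.1 p.2) :=
        measureReal_biUnion_finset_le _ _
    _ ≤ _ := Finset.sum_le_card_nsmul _ _ _ fun p hp => hS p.1 p.2 (Finset.mem_product.1 hp).2
    _ = 2 * A * (k - 1 : ℕ) * Real.exp (-(4 * α * Real.log (fA A k))) := by
        rw [Finset.card_product, Finset.card_fin, Nat.card_Ico, nsmul_eq_mul, Nat.cast_mul]
        ring
    _ ≤ 2 * A * k * Real.exp (-(4 * α * Real.log (fA A k))) := by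
        gcongr
        exact Nat.sub_le k 1

theorem measureReal_not_concentrated_le_one_div [IsProbabilityMeasure P]
    (h : IsInteraction P F M arm rew) {α : ℝ} (hα : 1 / 2 ≤ α) (hk : 1 ≤ k) :
    P.real {ω | ¬ Concentrated α M (arm · ω) (rew · ω) k} ≤ 1 / (128 * ((k : ℝ) + 1) ^ 3) := by
  rcases Nat.eq_zero_or_pos A with rfl | hA
  · refine (h.measureReal_not_concentrated_le (by linarith) hk).trans ?_
    rw [Nat.cast_zero, mul_zero, zero_mul, zero_mul]
    positivity
  have hA' : (1 : ℝ) ≤ A := by exact_mod_cast hA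
  have hlog := log_fA_nonneg A k
  have hf : 16 * (A : ℝ) ^ 2 * ((k : ℝ) + 1) ^ 2 ≤ fA A k := le_add_of_nonneg_left zero_le_one
  calc _ ≤ _ := h.measureReal_not_concentrated_le (by linarith) hk
    _ ≤ 2 * A * k * Real.exp (-(2 * Real.log (fA A k))) := by
        gcongr ?_ * Real.exp (-(?_ * _))
        linarith
    _ = 2 * A * k / fA A k ^ 2 := by
        rw [Real.exp_neg, two_mul (Real.log _), Real.exp_add,
          Real.exp_log (zero_lt_one.trans_le (one_le_fA A k)), ← sq, div_eq_mul_inv]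
    _ ≤ 2 * A ^ 4 * (k + 1) / (16 * (A : ℝ) ^ 2 * ((k : ℝ) + 1) ^ 2) ^ 2 := by
        gcongr
        · exact le_self_pow₀ hA' (by norm_num)
        · linarith
    _ = 1 / (128 * ((k : ℝ) + 1) ^ 3) := by
        field_simp
        norm_num

end IsInteraction

end Hoeffding

section Good

variable {A : ℕ}

/-- The event, for the paths of both tasks, on which the high-tier arm of iteration `k` is
controlled. The copied arm is analysed at its last pull in the low-tier task, which is why the
intervals of this task must be valid on a window. -/
def IsGood (α : ℝ) (MLo MHi : Bandit A) (aLo aHi : ℕ → Fin A) (rLo rHi : ℕ → ℝ) (k : ℕ) : Prop :=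
  RecentlyConcentrated α MLo aLo rLo k ∧ Concentrated α MHi aHi rHi k

variable {Ω : Type*} [mΩ : MeasurableSpace Ω] {P : Measure Ω} [IsProbabilityMeasure P]
  {F : Filtration ℕ mΩ} {M MLo MHi : Bandit A} {arm armLo armHi : ℕ → Ω → Fin A}
  {rew rewLo rewHi : ℕ → Ω → ℝ} {α : ℝ} {k : ℕ}

theorem IsInteraction.measureReal_not_recentlyConcentrated_le (h : IsInteraction P F M arm rew)
    (hα : 1 / 2 ≤ α) (hk : 1 ≤ k) :
    P.real {ω | ¬ RecentlyConcentrated α M (arm · ω) (rew · ω) k}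
      ≤ k / (2 * ((k : ℝ) + 1) ^ 3) := by
  set T := (Finset.Icc 1 k).filter fun s => k ≤ 4 * s
  have hsub : {ω | ¬ RecentlyConcentrated α M (arm · ω) (rew · ω) k} ⊆
      ⋃ s ∈ T, {ω | ¬ Concentrated α M (arm · ω) (rew · ω) s} := by
    intro ω hω
    simp only [RecentlyConcentrated, Set.mem_ofPred_eq, not_forall] at hω
    obtain ⟨s, hsk, hks, hs⟩ := hω
    exact Set.mem_biUnion (Finset.mem_filter.2 ⟨Finset.mem_Icc.2 (by omega), hks⟩) hs
  have hT : ∀ s ∈ T, P.real {ω | ¬ Concentrated α M (arm · ω) (rew · ω) s} ≤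
      1 / (2 * ((k : ℝ) + 1) ^ 3) := by
    intro s hs
    obtain ⟨hs1, hks⟩ := Finset.mem_filter.1 hs
    have hks' : (k : ℝ) ≤ 4 * s := by exact_mod_cast hks
    calc _ ≤ 1 / (128 * ((s : ℝ) + 1) ^ 3) :=
          h.measureReal_not_concentrated_le_one_div hα (Finset.mem_Icc.1 hs1).1
      _ ≤ 1 / (128 * (((k : ℝ) + 1) / 4) ^ 3) := by
          gcongr
          linarith
      _ = 1 / (2 * ((k : ℝ) + 1) ^ 3) := by ring
  calc _ ≤ _ := measureReal_mono hsub (measure_ne_top _ _)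
    _ ≤ ∑ s ∈ T, P.real {ω | ¬ Concentrated α M (arm · ω) (rew · ω) s} :=
        measureReal_biUnion_finset_le _ _
    _ ≤ T.card • (1 / (2 * ((k : ℝ) + 1) ^ 3)) := Finset.sum_le_card_nsmul _ _ _ hT
    _ ≤ (Finset.Icc 1 k).card • (1 / (2 * ((k : ℝ) + 1) ^ 3)) := by
        gcongr
        exact Finset.filter_subset _ _
    _ = k / (2 * ((k : ℝ) + 1) ^ 3) := by
        rw [Nat.card_Icc, Nat.add_sub_cancel, nsmul_eq_mul, mul_one_div]

theorem measureReal_not_isGood_le (hLo : IsInteraction P F MLo armLo rewLo)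
    (hHi : IsInteraction P F MHi armHi rewHi) (hα : 1 / 2 ≤ α) (hk : 1 ≤ k) :
    P.real {ω | ¬ IsGood α MLo MHi (armLo · ω) (armHi · ω) (rewLo · ω) (rewHi · ω) k}
      ≤ (((k : ℝ) + 1) ^ 2)⁻¹ := by
  have hsub : {ω | ¬ IsGood α MLo MHi (armLo · ω) (armHi · ω) (rewLo · ω) (rewHi · ω) k} ⊆
      {ω | ¬ RecentlyConcentrated α MLo (armLo · ω) (rewLo · ω) k} ∪
        {ω | ¬ Concentrated α MHi (armHi · ω) (rewHi · ω) k} := fun _ => not_and_or.1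
  calc _ ≤ _ := measureReal_mono hsub
    _ ≤ _ := measureReal_union_le _ _
    _ ≤ k / (2 * ((k : ℝ) + 1) ^ 3) + 1 / (128 * ((k : ℝ) + 1) ^ 3) :=
        add_le_add (hLo.measureReal_not_recentlyConcentrated_le hα hk)
          (hHi.measureReal_not_concentrated_le_one_div hα hk)
    _ ≤ (k + 1) / ((k : ℝ) + 1) ^ 3 := by
        rw [← sub_nonneg]
        have : (k + 1) / ((k : ℝ) + 1) ^ 3
            - (k / (2 * ((k : ℝ) + 1) ^ 3) + 1 / (128 * ((k : ℝ) + 1) ^ 3))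
            = (k / 2 + 127 / 128) / ((k : ℝ) + 1) ^ 3 := by field_simp; ring
        rw [this]
        positivity
    _ = (((k : ℝ) + 1) ^ 2)⁻¹ := by field_simp

theorem sum_inv_add_one_sq_le_one (K : ℕ) : ∑ k ∈ Finset.Icc 1 K, (((k : ℝ) + 1) ^ 2)⁻¹ ≤ 1 := by
  calc ∑ k ∈ Finset.Icc 1 K, (((k : ℝ) + 1) ^ 2)⁻¹
      = ∑ k ∈ Finset.Ioc 1 (K + 1), ((k : ℝ) ^ 2)⁻¹ := by
        rw [← Finset.Ico_add_one_right_eq_Icc, ← Finset.Ico_add_one_add_one_eq_Ioc,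
          ← Finset.sum_Ico_add' (fun k : ℕ => ((k : ℝ) ^ 2)⁻¹)]
        simp only [Nat.cast_add, Nat.cast_one]
    _ ≤ ((1 : ℕ) : ℝ)⁻¹ - ((K + 1 : ℕ) : ℝ)⁻¹ := sum_Ioc_inv_sq_le_sub one_ne_zero (by omega)
    _ ≤ 1 := by
        rw [Nat.cast_one, inv_one]
        exact sub_le_self _ (by positivity)

end Good

section Regret

variable {A : ℕ} {M : Bandit A} {i : Fin A}

theorem invGapSum_nonneg (M : Bandit A) : 0 ≤ invGapSum M :=
  Finset.sum_nonneg fun i _ => one_div_nonneg.2 (M.gap_nonneg i)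

theorem one_le_invGapSum (hi : ¬ M.IsOptimal i) : 1 ≤ invGapSum M := by
  classical
  have hpos := Bandit.gap_pos_iff_not_isOptimal.2 hi
  calc (1 : ℝ) ≤ 1 / M.gap i := (one_le_div hpos).2 (M.gap_le_one i)
    _ ≤ invGapSum M := Finset.single_le_sum (f := fun i => 1 / M.gap i)
        (fun j _ => one_div_nonneg.2 (M.gap_nonneg j)) (by simpa using hpos)

theorem invGapSum_eq_zero (h : ∀ i, M.IsOptimal i) : invGapSum M = 0 := by
  classical
  have hgap : ∀ i, M.gap i = 0 := fun i => Bandit.isOptimal_iff_gap_eq_zero.1 (h i)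
  simp [invGapSum, hgap]

theorem sum_gap_le {a : ℕ → Fin A} {S : Finset ℕ} {B : ℝ} (hB : 0 ≤ B)
    (hS : ∀ k ∈ S, 1 ≤ k ∧ pulls a k (a k) * M.gap (a k) ^ 2 ≤ B) :
    ∑ k ∈ S, M.gap (a k) ≤ (B + 1) * invGapSum M := by
  classical
  rw [invGapSum, Finset.mul_sum, Finset.sum_filter, ← Finset.sum_fiberwise S a]
  refine Finset.sum_le_sum fun i _ => ?_
  rw [Finset.sum_congr rfl fun k hk => by rw [(Finset.mem_filter.1 hk).2], Finset.sum_const,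
    nsmul_eq_mul]
  split_ifs with hi
  · have hcard : ((S.filter fun k => a k = i).card : ℝ) ≤ B / M.gap i ^ 2 + 1 := by
      refine card_le_add_one_of_forall_pulls_le a (i := i) (by positivity) fun k hk => ?_
      obtain ⟨hkS, rfl⟩ := Finset.mem_filter.1 hk
      exact ⟨(hS k hkS).1, rfl, (le_div_iff₀ (by positivity)).2 (hS k hkS).2⟩
    calc _ ≤ (B / M.gap i ^ 2 + 1) * M.gap i := by gcongr
      _ = (B + M.gap i ^ 2) * (1 / M.gap i) := by field_simp
      _ ≤ (B + 1) * (1 / M.gap i) := by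
        gcongr
        exact pow_le_one₀ (M.gap_nonneg i) (M.gap_le_one i)
  · rw [le_antisymm (not_lt.1 hi) (M.gap_nonneg i), mul_zero]

variable {Ω : Type*} [mΩ : MeasurableSpace Ω] {P : Measure Ω} {arm : ℕ → Ω → Fin A} {D : ℝ}

theorem regret_eq_zero (h : ∀ i, M.IsOptimal i) (K : ℕ) : regret P M arm K = 0 := by
  have hgap : ∀ i, M.bestMean - M.mean i = 0 := fun i => Bandit.isOptimal_iff_gap_eq_zero.1 (h i)
  simp [regret, hgap]

open Classical in
/-- The bad events need not be measurable; they are replaced by their measurable hulls. -/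
theorem regret_le_add_sum_measureReal_not [IsProbabilityMeasure P] (good : ℕ → Ω → Prop) (K : ℕ)
    (hD : ∀ ω, ∑ k ∈ (Finset.Icc 1 K).filter (good · ω), M.gap (arm k ω) ≤ D) :
    regret P M arm K ≤ D + ∑ k ∈ Finset.Icc 1 K, P.real {ω | ¬ good k ω} := by
  set T : ℕ → Set Ω := fun k => toMeasurable P {ω | ¬ good k ω}
  have hT : ∀ k, MeasurableSet (T k) := fun k => measurableSet_toMeasurable _ _
  have hint : ∀ k, Integrable ((T k).indicator 1 : Ω → ℝ) P := fun k =>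
    (integrable_const 1).indicator (hT k)
  have hpath : ∀ ω, ∑ k ∈ Finset.Icc 1 K, M.gap (arm k ω)
      ≤ D + ∑ k ∈ Finset.Icc 1 K, (T k).indicator 1 ω := by
    intro ω
    rw [← Finset.sum_filter_add_sum_filter_not _ (good · ω)]
    refine add_le_add (hD ω) ?_
    rw [Finset.sum_filter]
    refine Finset.sum_le_sum fun k _ => ?_
    split_ifs with hk
    · exact Set.indicator_nonneg (fun _ _ => zero_le_one) _
    · rw [Set.indicator_of_mem (subset_toMeasurable _ _ hk)]
      exact M.gap_le_one _
  calc regret P M arm K ≤ ∫ ω, (D + ∑ k ∈ Finset.Icc 1 K, (T k).indicator 1 ω) ∂P :=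
        integral_mono_of_nonneg
          (Filter.Eventually.of_forall fun ω => Finset.sum_nonneg fun k _ => M.gap_nonneg _)
          ((integrable_const D).add (integrable_finsetSum _ fun k _ => hint k))
          (Filter.Eventually.of_forall hpath)
    _ = D + ∑ k ∈ Finset.Icc 1 K, P.real (T k) := by
        rw [integral_add (integrable_const D) (integrable_finsetSum _ fun k _ => hint k),
          integral_finsetSum _ fun k _ => hint k, integral_const, probReal_univ, one_smul]
        simp only [integral_indicator_one (hT _)]
    _ = D + ∑ k ∈ Finset.Icc 1 K, P.real {ω | ¬ good k ω} := by
        simp only [T, measureReal_def, measure_toMeasurable]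

end Regret

section BurnIn

variable {A k : ℕ} {α x Δ : ℝ}

/-- The number of iterations after which, in close tasks with `A / Δ_min = x`, the copied arm is
optimal at every good iteration. The factor `640` is `32 * 20`, from the bound
`log f(k) ≤ 20 log √k ≤ 20 (√k - 1)`. -/
def burnIn (α x : ℝ) : ℕ := ⌈(640 * α * x ^ 2) ^ 2⌉₊

theorem le_burnIn (hα : 1 / 2 ≤ α) (hx : 1 ≤ x) : x ≤ burnIn α x :=
  calc x ≤ 320 * x ^ 2 := by nlinarith
    _ ≤ 640 * α * x ^ 2 := by
        gcongr
        linarith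
    _ ≤ (640 * α * x ^ 2) ^ 2 := le_self_pow₀ (by nlinarith) two_ne_zero
    _ ≤ burnIn α x := Nat.le_ceil _

theorem log_burnIn_le (hα : 1 / 2 ≤ α) (hx : 2 ≤ x) :
    Real.log (burnIn α x) ≤ (Real.logb 2 (2 * (640 * α) ^ 2) + 4) * Real.log x := by
  have hpoly : (burnIn α x : ℝ) ≤ 2 * (640 * α) ^ 2 * x ^ 4 := by
    have hone : 1 ≤ (640 * α * x ^ 2) ^ 2 := one_le_pow₀ (by nlinarith)
    have hceil := (Nat.ceil_lt_add_one (zero_le_one.trans hone)).le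
    unfold burnIn
    linarith
  have hpos : (0 : ℝ) < burnIn α x := by linarith [le_burnIn hα (one_le_two.trans hx)]
  have hlogb : 0 ≤ Real.logb 2 (2 * (640 * α) ^ 2) :=
    Real.logb_nonneg one_lt_two (by nlinarith)
  calc Real.log (burnIn α x) ≤ Real.log (2 * (640 * α) ^ 2 * x ^ 4) :=
        Real.log_le_log hpos hpoly
    _ = Real.logb 2 (2 * (640 * α) ^ 2) * Real.log 2 + 4 * Real.log x := by
        rw [Real.log_mul (by positivity) (by positivity), Real.log_pow, Real.logb,
          div_mul_cancel₀ _ (Real.log_pos one_lt_two).ne', Nat.cast_ofNat]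
    _ ≤ Real.logb 2 (2 * (640 * α) ^ 2) * Real.log x + 4 * Real.log x := by gcongr
    _ = _ := by ring

theorem lt_of_burnIn_lt (hα : 1 / 2 ≤ α) (hA : 2 ≤ A) (hΔ : 0 < Δ) (hΔ1 : Δ ≤ 1)
    (hk : burnIn α (A / Δ) < k) :
    8 * A * (1 + 4 * (α * Real.log (fA A k) / Δ ^ 2)) < k := by
  set x : ℝ := A / Δ with hx_def
  have hA' : (2 : ℝ) ≤ A := by exact_mod_cast hA
  have hAx : (A : ℝ) ≤ x := le_div_self (by positivity) hΔ hΔ1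
  have hAk : A < k := by
    have : (A : ℝ) < k := (hAx.trans (le_burnIn hα (by linarith))).trans_lt (Nat.cast_lt.2 hk)
    exact_mod_cast this
  have hk0 : (0 : ℝ) < k := by linarith [(Nat.cast_lt (α := ℝ)).2 hAk]
  have hsqrt : 640 * α * x ^ 2 < √(k : ℝ) := Real.lt_sqrt_of_sq_lt (Nat.lt_of_ceil_lt hk)
  have hlog : Real.log (fA A k) ≤ 20 * (√(k : ℝ) - 1) :=
    calc Real.log (fA A k) ≤ 10 * Real.log k := log_fA_le hAk.le (by omega)
      _ = 20 * Real.log (√(k : ℝ)) := by rw [Real.log_sqrt hk0.le]; ring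
      _ ≤ 20 * (√(k : ℝ) - 1) := by
          gcongr
          exact Real.log_le_sub_one_of_pos (Real.sqrt_pos.2 hk0)
  have hlog0 := log_fA_nonneg A k
  have hAΔ : A / Δ ^ 2 ≤ x ^ 2 := by
    rw [hx_def, div_pow]
    gcongr
    exact le_self_pow₀ (by linarith) two_ne_zero
  calc 8 * A * (1 + 4 * (α * Real.log (fA A k) / Δ ^ 2))
      = 8 * A + 32 * α * Real.log (fA A k) * (A / Δ ^ 2) := by ring
    _ ≤ 8 * A + 32 * α * (20 * (√(k : ℝ) - 1)) * x ^ 2 := by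
        have hlog1 := hlog0.trans hlog
        gcongr
    _ ≤ 640 * α * x ^ 2 * √(k : ℝ) := by nlinarith
    _ < √(k : ℝ) * √(k : ℝ) := by gcongr
    _ = k := Real.mul_self_sqrt hk0.le

end BurnIn

section TieredRun

variable {A : ℕ} {Ω : Type*} [mΩ : MeasurableSpace Ω] {P : Measure Ω} {F : Filtration ℕ mΩ}
  {MLo MHi : Bandit A} {armLo armHi : ℕ → Ω → Fin A} {rewLo rewHi : ℕ → Ω → ℝ} {α ε : ℝ}
  {k K : ℕ} {i : Fin A}

namespace IsTieredRun

theorem isUCBPathLo (h : IsTieredRun α ε MLo MHi P F armLo armHi rewLo rewHi) (ω : Ω) :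
    IsUCBPath α (armLo · ω) (rewLo · ω) :=
  ⟨h.initLo ω, h.ruleLo ω⟩

theorem pulls_mul_gap_sq_le (h : IsTieredRun α ε MLo MHi P F armLo armHi rewLo rewHi)
    (hα : 0 ≤ α) (hovd : OptValueDominance MLo MHi) (hε : ε ≤ deltaMin MLo MHi / 4) (ω : Ω)
    (hgood : IsGood α MLo MHi (armLo · ω) (armHi · ω) (rewLo · ω) (rewHi · ω) k) :
    pulls (armHi · ω) k (armHi k ω) * MHi.gap (armHi k ω) ^ 2
      ≤ 3200 * α * Real.log (fA A k) := by
  obtain ⟨hconcLo, hconcHi⟩ := hgood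
  have hlog := log_fA_nonneg A k
  rcases Nat.lt_or_ge A k with hkA | hkA
  · have hpos := pulls_pos_of_init (h.initHi ω) hkA
    have hwidth : 0 ≤ width α (armHi · ω) k (armHi k ω) := Real.sqrt_nonneg _
    have hgap : MHi.gap (armHi k ω) ≤ 40 * width α (armHi · ω) k (armHi k ω) := by
      obtain ⟨j, -, hcopy, hucb⟩ := h.ruleHi ω k hkA
      by_cases hcheck : CheckEvent α ε (armLo · ω) (armHi · ω) (rewLo · ω) (rewHi · ω) k j
      · rw [hcopy hcheck]
        exact gap_le_of_checkEvent_of_optValueDominance hovd hε (h.isUCBPathLo ω) hα hkA hconcLo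
          hconcHi (hpos j) hcheck
      · linarith [hconcHi.gap_le_of_isArgmax_ucb hpos (hucb hcheck)]
    exact (pulls_mul_sq_le_of_le_mul_width hα (hpos _) (MHi.gap_nonneg _) hgap).trans_eq (by ring)
  · rw [pulls_eq_zero_of_init (h.initHi ω) hkA, Nat.cast_zero, zero_mul]
    positivity

open Classical in
theorem sum_gap_le_of_isGood (h : IsTieredRun α ε MLo MHi P F armLo armHi rewLo rewHi)
    (hα : 0 ≤ α) (hovd : OptValueDominance MLo MHi) (hε : ε ≤ deltaMin MLo MHi / 4) {y : ℝ}
    (hy : 0 ≤ y) (ω : Ω)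
    (hL : ∀ k, A < k → k ≤ K →
      IsGood α MLo MHi (armLo · ω) (armHi · ω) (rewLo · ω) (rewHi · ω) k →
      0 < MHi.gap (armHi k ω) → Real.log (fA A k) ≤ 10 * y) :
    ∑ k ∈ (Finset.Icc 1 K).filter
        (IsGood α MLo MHi (armLo · ω) (armHi · ω) (rewLo · ω) (rewHi · ω)), MHi.gap (armHi k ω)
      ≤ (32000 * α * y + 1) * invGapSum MHi := by
  refine sum_gap_le (a := (armHi · ω)) (by positivity) fun k hk => ?_
  obtain ⟨hkK, hgood⟩ := Finset.mem_filter.1 hk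
  rw [Finset.mem_Icc] at hkK
  refine ⟨hkK.1, ?_⟩
  rcases Nat.lt_or_ge A k with hkA | hkA
  · rcases (MHi.gap_nonneg (armHi k ω)).eq_or_lt with hgap | hgap
    · rw [← hgap, zero_pow two_ne_zero, mul_zero]
      positivity
    · calc _ ≤ 3200 * α * Real.log (fA A k) := h.pulls_mul_gap_sq_le hα hovd hε ω hgood
        _ ≤ 3200 * α * (10 * y) := by
            gcongr
            exact hL k hkA hkK.2 hgood hgap
        _ = 32000 * α * y := by ring
  · rw [pulls_eq_zero_of_init (h.initHi ω) hkA, Nat.cast_zero, zero_mul]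
    positivity

theorem regret_le [IsProbabilityMeasure P]
    (h : IsTieredRun α ε MLo MHi P F armLo armHi rewLo rewHi) (hα : 1 / 2 ≤ α)
    (hovd : OptValueDominance MLo MHi) (hε : ε ≤ deltaMin MLo MHi / 4) {y : ℝ}
    (hy : Real.log 2 ≤ y)
    (hL : ∀ ω k, A < k → k ≤ K →
      IsGood α MLo MHi (armLo · ω) (armHi · ω) (rewLo · ω) (rewHi · ω) k →
      0 < MHi.gap (armHi k ω) → Real.log (fA A k) ≤ 10 * y) :
    regret P MHi armHi K ≤ (32000 * α + 4) * (invGapSum MHi * y) := by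
  by_cases hopt : ∀ i, MHi.IsOptimal i
  · simp [regret_eq_zero hopt, invGapSum_eq_zero hopt]
  obtain ⟨i, hi⟩ := not_forall.1 hopt
  have hS := one_le_invGapSum hi
  have hy_half : 1 / 2 ≤ y := by linarith [Real.log_two_gt_d9]
  set good : ℕ → Ω → Prop := fun k ω =>
    IsGood α MLo MHi (armLo · ω) (armHi · ω) (rewLo · ω) (rewHi · ω) k
  calc regret P MHi armHi K
      ≤ (32000 * α * y + 1) * invGapSum MHi + ∑ k ∈ Finset.Icc 1 K, P.real {ω | ¬ good k ω} :=
        regret_le_add_sum_measureReal_not good K fun ω =>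
          h.sum_gap_le_of_isGood (by linarith) hovd hε (by linarith) ω (hL ω)
    _ ≤ (32000 * α * y + 1) * invGapSum MHi + ∑ k ∈ Finset.Icc 1 K, (((k : ℝ) + 1) ^ 2)⁻¹ := by
        gcongr with k hk
        exact measureReal_not_isGood_le h.interactLo h.interactHi hα (Finset.mem_Icc.1 hk).1
    _ ≤ (32000 * α * y + 1) * invGapSum MHi + invGapSum MHi := by
        gcongr
        exact (sum_inv_add_one_sq_le_one K).trans hS
    _ ≤ (32000 * α + 4) * (invGapSum MHi * y) := by nlinarith

theorem regret_le_log [IsProbabilityMeasure P]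
    (h : IsTieredRun α ε MLo MHi P F armLo armHi rewLo rewHi) (hα : 1 / 2 ≤ α)
    (hovd : OptValueDominance MLo MHi) (hε : ε ≤ deltaMin MLo MHi / 4) (hK : 2 ≤ K) :
    regret P MHi armHi K ≤ (32000 * α + 4) * (invGapSum MHi * Real.log K) := by
  refine h.regret_le hα hovd hε
    (Real.log_le_log two_pos (by exact_mod_cast hK)) fun ω k hkA hkK _ hgap => ?_
  have hA := Bandit.two_le_of_not_isOptimal (Bandit.gap_pos_iff_not_isOptimal.1 hgap)
  have hk : (0 : ℝ) < k := Nat.cast_pos.2 (by omega)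
  exact (log_fA_le hkA.le (by omega)).trans (by gcongr)

theorem gap_eq_zero_of_isClose (h : IsTieredRun α ε MLo MHi P F armLo armHi rewLo rewHi)
    (hα : 0 ≤ α) (hclose : IsClose ε MLo MHi) (hopt : MLo.IsOptimal i) {Δ : ℝ} (hΔ : 0 < Δ)
    (hi : ∀ j, j ≠ i → Δ ≤ MLo.gap j) (hkA : A < k)
    (hk : 8 * A * (1 + 4 * (α * Real.log (fA A k) / Δ ^ 2)) < k) (ω : Ω)
    (hgood : IsGood α MLo MHi (armLo · ω) (armHi · ω) (rewLo · ω) (rewHi · ω) k) :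
    MHi.gap (armHi k ω) = 0 := by
  obtain ⟨hconcLo, hconcHi⟩ := hgood
  have hoptHi : MHi.IsOptimal i := (hclose.2 i).1 hopt
  have hpathLo := h.isUCBPathLo ω
  obtain ⟨j, hmax, hcopy, -⟩ := h.ruleHi ω k hkA
  obtain rfl : j = i := hpathLo.eq_of_isArgmax_lcb hα hkA hconcLo hΔ hopt hi hk hmax
  have hcheck : CheckEvent α ε (armLo · ω) (armHi · ω) (rewLo · ω) (rewHi · ω) k j := by
    refine ⟨?_, hpathLo.half_lt_pulls hα hconcLo hΔ hi hk⟩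
    have hlcb := (hconcLo k le_rfl (by omega)).lcb_le_mean (pulls_pos_of_init (h.initLo ω) hkA j)
    have hucb := hconcHi.mean_le_ucb (pulls_pos_of_init (h.initHi ω) hkA j)
    rw [hopt.mean_eq] at hlcb
    rw [hoptHi.mean_eq] at hucb
    linarith [hclose.1]
  rw [hcopy hcheck]
  exact Bandit.isOptimal_iff_gap_eq_zero.1 hoptHi

theorem regret_le_of_isClose [IsProbabilityMeasure P]
    (h : IsTieredRun α ε MLo MHi P F armLo armHi rewLo rewHi) (hα : 1 / 2 ≤ α)
    (hovd : OptValueDominance MLo MHi) (hε : ε ≤ deltaMin MLo MHi / 4)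
    (huniq : ∃! i, MLo.IsOptimal i) (hclose : IsClose ε MLo MHi) (K : ℕ) :
    regret P MHi armHi K ≤ (32000 * α + 4) * (Real.logb 2 (2 * (640 * α) ^ 2) + 4) *
      (invGapSum MHi * Real.log (A / deltaMin MLo MHi)) := by
  by_cases hall : ∀ j, MHi.IsOptimal j
  · simp [regret_eq_zero hall, invGapSum_eq_zero hall]
  obtain ⟨j, hj⟩ := not_forall.1 hall
  obtain ⟨i, hopt, hi⟩ := huniq
  have hA : 2 ≤ A := Bandit.two_le_of_not_isOptimal hj
  have hA' : (2 : ℝ) ≤ A := by exact_mod_cast hA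
  have hΔ : 0 < deltaMin MLo MHi :=
    lt_min (Bandit.minGap_pos (mt (hclose.2 j).1 hj)) (Bandit.minGap_pos hj)
  have hΔ1 : deltaMin MLo MHi ≤ 1 :=
    (min_le_right _ _).trans ((Bandit.minGap_le hj).trans (MHi.gap_le_one j))
  have hgap : ∀ l, l ≠ i → deltaMin MLo MHi ≤ MLo.gap l := fun l hl =>
    (min_le_left _ _).trans (Bandit.minGap_le (mt (hi l) hl))
  set x : ℝ := A / deltaMin MLo MHi
  have hx : 2 ≤ x := hA'.trans (le_div_self (by positivity) hΔ hΔ1)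
  have hburn : 2 ≤ (burnIn α x : ℝ) := hx.trans (le_burnIn hα (one_le_two.trans hx))
  have hS := invGapSum_nonneg MHi
  calc regret P MHi armHi K ≤ (32000 * α + 4) * (invGapSum MHi * Real.log (burnIn α x)) := by
        refine h.regret_le hα hovd hε (Real.log_le_log two_pos hburn)
          fun ω k hkA _ hgood hpos => ?_
        have hk : k ≤ burnIn α x := by
          by_contra! hk
          have hk' := lt_of_burnIn_lt hα hA hΔ hΔ1 hk
          exact hpos.ne'
            (h.gap_eq_zero_of_isClose (by linarith) hclose hopt hΔ hgap hkA hk' ω hgood)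
        have hk0 : (0 : ℝ) < k := Nat.cast_pos.2 (by omega)
        exact (log_fA_le hkA.le (by omega)).trans (by gcongr)
    _ ≤ (32000 * α + 4) *
        (invGapSum MHi * ((Real.logb 2 (2 * (640 * α) ^ 2) + 4) * Real.log x)) := by
        gcongr
        exact log_burnIn_le hα hx
    _ = _ := by ring

end IsTieredRun

end TieredRun

end

end TieredMAB

theorem mainTheorem3_general (α : ℝ) (hα : 1 / 2 ≤ α) :
    ∃ C : ℝ, 0 < C ∧
      ∀ (A : ℕ) (MLo MHi : TieredMAB.Bandit A) (ε : ℝ),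
        TieredMAB.OptValueDominance MLo MHi →
        ε ≤ TieredMAB.deltaMin MLo MHi / 4 →
        ∀ (Ω : Type*) (mΩ : MeasurableSpace Ω) (P : MeasureTheory.Measure Ω)
          (_ : MeasureTheory.IsProbabilityMeasure P) (F : MeasureTheory.Filtration ℕ mΩ)
          (armLo armHi : ℕ → Ω → Fin A) (rewLo rewHi : ℕ → Ω → ℝ),
          TieredMAB.IsTieredRun α ε MLo MHi P F armLo armHi rewLo rewHi →
          (∀ K : ℕ, 2 ≤ K →
            TieredMAB.regret P MHi armHi K ≤ C * (TieredMAB.invGapSum MHi * Real.log K)) ∧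
          ((∃! i, MLo.IsOptimal i) → TieredMAB.IsClose ε MLo MHi →
            ∀ K : ℕ, TieredMAB.regret P MHi armHi K ≤
              C * (TieredMAB.invGapSum MHi *
                Real.log ((A : ℝ) / TieredMAB.deltaMin MLo MHi))) := by
  have hlogb : 0 ≤ Real.logb 2 (2 * (640 * α) ^ 2) := Real.logb_nonneg one_lt_two (by nlinarith)
  refine ⟨(32000 * α + 4) * (Real.logb 2 (2 * (640 * α) ^ 2) + 4), by positivity,
    fun A MLo MHi ε hovd hε Ω mΩ P _ F armLo armHi rewLo rewHi hrun =>
      ⟨fun K hK => (hrun.regret_le_log hα hovd hε hK).trans ?_, fun huniq hclose =>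
        hrun.regret_le_of_isClose hα hovd hε huniq hclose⟩⟩
  gcongr
  · exact mul_nonneg (TieredMAB.invGapSum_nonneg MHi) (Real.log_natCast_nonneg K)
  · exact le_mul_of_one_le_right (by positivity) (by linarith)

theorem mainTheorem3 (α : ℝ) (hα : 2 < α) :
    ∃ C : ℝ, 0 < C ∧
      ∀ (A : ℕ) (MLo MHi : TieredMAB.Bandit A) (dTilde : ℝ),
        (∃! i, MLo.IsOptimal i) → (∃! i, MHi.IsOptimal i) →
        TieredMAB.OptValueDominance MLo MHi →
        0 ≤ dTilde → dTilde ≤ TieredMAB.deltaMin MLo MHi →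
        ∀ (Ω : Type*) (mΩ : MeasurableSpace Ω) (P : MeasureTheory.Measure Ω)
          (_ : MeasureTheory.IsProbabilityMeasure P) (F : MeasureTheory.Filtration ℕ mΩ)
          (armLo armHi : ℕ → Ω → Fin A) (rewLo rewHi : ℕ → Ω → ℝ),
          TieredMAB.IsTieredRun α (dTilde / 4) MLo MHi P F armLo armHi rewLo rewHi →
          (∀ K : ℕ, 2 ≤ K →
            TieredMAB.regret P MHi armHi K ≤ C * (TieredMAB.invGapSum MHi * Real.log K)) ∧
          (TieredMAB.IsClose (dTilde / 4) MLo MHi →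
            ∀ K : ℕ, TieredMAB.regret P MHi armHi K ≤
              C * (TieredMAB.invGapSum MHi *
                Real.log ((A : ℝ) / TieredMAB.deltaMin MLo MHi))) := by
  obtain ⟨C, hC, hbound⟩ := mainTheorem3_general α (by linarith)
  exact ⟨C, hC, fun A MLo MHi dTilde huniq _ hovd _ hd Ω mΩ P hP F armLo armHi rewLo rewHi hrun =>
    (hbound A MLo MHi _ hovd (by gcongr) Ω mΩ P hP F _ _ _ _ hrun).imp_right fun h => h huniq⟩
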